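/- Let $\Gamma$ be a simple graph with $d$ vertices, let $\mathbf m=(m_e)_{e}$ be positive integers on its edges (bond dimensions) and $\mathbf n=(n_v)_{v}$ positive integers on its vertices (local dimensions). Put $W_v=\bigotimes_{e\ni v}\mathbb C^{m_e}$ and $V_v=\mathbb C^{n_v}$, and let $T(\Gamma,\mathbf m)\in\bigotimes_v W_v$ be the graph tensor, i.e. the Kronecker product over all edges $e=\{v,w\}$ of the identity tensors $\sum_{j=1}^{m_e} e_j\otimes e_j\in\mathbb C^{m_e}\otimes\mathbb C^{m_e}$ placed on the factors $v$ and $w$. The tensor network variety $\mathcal{T\!N\!S}^{\Gamma}_{\mathbf m,\mathbf n}$ is the Zariski closure in $\bigotimes_v V_v$ of the set of all tensors $(\bigotimes_v X_v)\cdot T(\Gamma,\mathbf m)$ with $X_v\in\mathrm{Hom}(W_v,V_v)$. Its expected dimension is $$\min\Bigl\{\sum_{v}\bigl(n_v\textstyle\prod_{e\ni v}m_e\bigr)-d+1-\sum_{e}(m_e^2-1),\ \prod_v n_v\Bigr\}.$$ For $T=(T_{abcd})\in V_1\otimes V_2\otimes V_3\otimes V_4=(\mathbb C^2)^{\otimes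 4}$ let $F(T)=\det\bigl(\sum_{a,c}x_a y_c T_{abcd}\bigr)_{b,d}$, a form of bidegree $(2,2)$ in $(x_0,x_1)$ and $(y_0,y_1)$. Let $I_6(T)$ be the determinant of the $3\times3$ matrix of coefficients of $F(T)$ with respect to the monomials $x_0^2,x_0x_1,x_1^2$ and $y_0^2,y_0y_1,y_1^2$. **Theorem.** Let $C_4$ be the cycle on the vertices $1,2,3,4$ (in this cyclic order), $\mathbf m=(2,2,2,2)$ and $\mathbf n=(2,2,2,2)$. Then the expected dimension of $\mathcal{T\!N\!S}^{C_4}_{\mathbf m,\mathbf n}$ is $16$, but $$\dim\mathcal{T\!N\!S}^{C_4}_{\mathbf m,\mathbf n}=15 .$$ More precisely, $\mathcal{T\!N\!S}^{C_4}_{\mathbf m,\mathbf n}$ is a hypersurface of degree $6$ in $(\mathbb C^2)^{\otimes 4}$: the polynomial $I_6$ in the $16$ coordinates of $T$ is irreducible over $\mathbb C$ and homogeneous of degree $6$; it is an invariant, in the sense that $I_6\bigl((g_1\otimes g_2\otimes g_3\otimes g_4)T\bigr)=(\det g_1\det g_2\det g_3\det g_4)^3\,I_6(T)$ for all $g_i\in\mathrm{GL}_2(\mathbb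 C)$ and all $T$; one has $\mathcal{T\!N\!S}^{C_4}_{\mathbf m,\mathbf n}=\{T: I_6(T)=0\}$; and $I_6$ generates the ideal of all polynomials vanishing on $\mathcal{T\!N\!S}^{C_4}_{\mathbf m,\mathbf n}$. -/

import Mathlib

/-!
# Tensor network varieties in coordinates

Every vector space `ℂ^k` is taken with its standard basis; a tensor in
`V_1 ⊗ ⋯ ⊗ V_d` is the array of its coordinates, a linear map is its matrix.
-/

namespace TensorNetwork

section Network

variable {V : Type} [Fintype V] [DecidableEq V]

/-- `(X_1 ⊗ ⋯ ⊗ X_d) · T` for linear maps `X_i : ℂ^{κ i} → ℂ^{ι i}` and a tensor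
`T ∈ ⊗_i ℂ^{κ i}`. -/
def multiApply {ι κ : V → Type} [∀ i, Fintype (κ i)]
    (X : ∀ i, Matrix (ι i) (κ i) ℂ) (T : (∀ i, κ i) → ℂ) : (∀ i, ι i) → ℂ :=
  fun v => ∑ w : ∀ i, κ i, (∏ i, X i (v i) (w i)) * T w

variable (Γ : SimpleGraph V) [DecidableRel Γ.Adj]

/-- The edges of `Γ` at the vertex `i`. -/
abbrev EdgeAt (i : V) : Type := {e : Γ.edgeSet // i ∈ (e : Sym2 V)}

/-- The standard basis of `W_i = ⊗_{e ∋ i} ℂ^{m_e}`. -/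
abbrev BondIdx (m : Γ.edgeSet → ℕ) (i : V) : Type := (e : EdgeAt Γ i) → Fin (m e.1)

variable {Γ}

/-- The coordinates of `u_(e)(m_e) = ∑_j v_j^{(i_1)} ⊗ v_j^{(i_2)} ⊗ ⨂_{i ≠ i_1, i_2} v_0^{(i)}`
for `e = {i_1, i_2}`. A basis vector of `⊗_i W_i` is given by `w`, and only the indices that
the two endpoints of `e` carry on `e` matter for this factor. -/
def edgeTensor (m : Γ.edgeSet → ℕ) (e : Γ.edgeSet) (w : ∀ i, BondIdx Γ m i) : ℂ :=
  if ∀ (i j : V) (hi : i ∈ (e : Sym2 V)) (hj : j ∈ (e : Sym2 V)), w i ⟨e, hi⟩ = w j ⟨e, hj⟩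
  then 1 else 0

/-- The graph tensor `T(Γ, m)`: the Kronecker product over all edges of the tensors
`u_(e)(m_e)`. -/
def graphTensor (m : Γ.edgeSet → ℕ) : (∀ i, BondIdx Γ m i) → ℂ :=
  fun w => ∏ e : Γ.edgeSet, edgeTensor m e w

/-- The tensors `(X_1 ⊗ ⋯ ⊗ X_d) · T(Γ, m)` with `X_i ∈ Hom(W_i, ℂ^{n_i})`. -/
def tensorNetworkStates (m : Γ.edgeSet → ℕ) (n : V → ℕ) : Set ((∀ i, Fin (n i)) → ℂ) :=
  Set.range fun X : ∀ i, Matrix (Fin (n i)) (BondIdx Γ m i) ℂ => multiApply X (graphTensor m)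

/-- The tensor network variety: the Zariski closure of the set of tensor network states. -/
def tensorNetworkVariety (m : Γ.edgeSet → ℕ) (n : V → ℕ) : Set ((∀ i, Fin (n i)) → ℂ) :=
  MvPolynomial.zeroLocus ℂ (MvPolynomial.vanishingIdeal ℂ (tensorNetworkStates m n))

/-- The expected dimension of the tensor network variety: parameters modulo rescaling and
modulo the gauge subgroup, capped by the dimension of the ambient space. -/
def expectedDim (m : Γ.edgeSet → ℕ) (n : V → ℕ) : ℤ :=
  min ((∑ i, (n i : ℤ) * ∏ e : EdgeAt Γ i, (m e.1 : ℤ)) - Fintype.card V + 1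
      - ∑ e : Γ.edgeSet, ((m e : ℤ) ^ 2 - 1))
    (∏ i, (n i : ℤ))

end Network

/-- The dimension of an affine algebraic set: the Krull dimension of its coordinate ring. -/
noncomputable def affineDim {σ : Type} (Y : Set (σ → ℂ)) : WithBot ℕ∞ :=
  ringKrullDim (MvPolynomial σ ℂ ⧸ MvPolynomial.vanishingIdeal ℂ Y)

section Invariant

variable {R : Type} [CommRing R]

/-- The bilinear map `V_1^* × V_3^* → V_2 ⊗ V_4` of a `2 × 2 × 2 × 2` tensor, evaluated at
generic vectors `(x_0, x_1)` and `(y_0, y_1)`: a `2 × 2` matrix of forms of bidegree `(1, 1)`.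
The variables `x_a` are `X (Sum.inl a)` and the variables `y_c` are `X (Sum.inr c)`. -/
noncomputable def pencil (T : (Fin 4 → Fin 2) → R) :
    Matrix (Fin 2) (Fin 2) (MvPolynomial (Fin 2 ⊕ Fin 2) R) :=
  Matrix.of fun b d => ∑ a : Fin 2, ∑ c : Fin 2,
    MvPolynomial.C (T ![a, b, c, d]) *
      (MvPolynomial.X (Sum.inl a) * MvPolynomial.X (Sum.inr c))

/-- The form `F(T)` of bidegree `(2, 2)`. -/
noncomputable def biquadraticForm (T : (Fin 4 → Fin 2) → R) :
    MvPolynomial (Fin 2 ⊕ Fin 2) R :=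
  (pencil T).det

/-- The exponent of `x_0^{2-r} x_1^r y_0^{2-s} y_1^s`. -/
noncomputable def biquadraticExponent (r s : Fin 3) : Fin 2 ⊕ Fin 2 →₀ ℕ :=
  Finsupp.single (Sum.inl 0) (2 - (r : ℕ)) + Finsupp.single (Sum.inl 1) (r : ℕ) +
    (Finsupp.single (Sum.inr 0) (2 - (s : ℕ)) + Finsupp.single (Sum.inr 1) (s : ℕ))

/-- The `3 × 3` matrix of `F(T)` in the monomial bases `x_0², x_0 x_1, x_1²` and
`y_0², y_0 y_1, y_1²`. -/
noncomputable def biquadraticMatrix (T : (Fin 4 → Fin 2) → R) : Matrix (Fin 3) (Fin 3) R :=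
  Matrix.of fun r s => MvPolynomial.coeff (biquadraticExponent r s) (biquadraticForm T)

end Invariant

/-- The polynomial `I_6` in the `16` coordinates of a `2 × 2 × 2 × 2` tensor: the determinant
of the `3 × 3` matrix of `F(T)` for the generic tensor `T`. -/
noncomputable def invariantSix : MvPolynomial (Fin 4 → Fin 2) ℂ :=
  (biquadraticMatrix (fun k : Fin 4 → Fin 2 =>
    (MvPolynomial.X k : MvPolynomial (Fin 4 → Fin 2) ℂ))).det

end TensorNetwork

/-! For a state of the 4-cycle, `F(T)` evaluated at `(x, y)` is `det (tr (P B_b Q D_d))`, with `P`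
linear in `x` and `Q` linear in `y`. By `traceForm_eq` this is `det Q` times a quadratic form in `P`
plus `det P` times a quadratic form in `Q`. So the `3 × 3` matrix of `F(T)` has rank at most 2, and
`I_6` vanishes on all states (`det_sliceMatrix_cycleState`).

Conversely, nothing else vanishes there. `I_6` is irreducible, since a linear substitution turns it
into an irreducible polynomial of the same degree (`irreducible_invariantSix`). Fifteen of the
sixteen coordinates are algebraically independent on the states, by the Jacobian criterion at one
integral point (`algebraicIndependent_cycleState`). An ideal containing an irreducible polynomial
but no nonzero polynomial in the other fifteen variables is generated by that polynomial
(`eq_span_singleton_of_irreducible`, by Gauss's lemma). The equation of the variety and its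
dimension follow; invariance is checked one tensor factor at a time. -/

namespace MvPolynomial

/-! ### Polynomial rings: Jacobian criterion, principal ideals, irreducibility, dimension of
hypersurfaces. -/

/-- The chain rule for a derivation applied to a polynomial expression. -/
theorem derivation_aeval {ι K S : Type*} [CommRing K] [CommRing S] [Algebra K S] [Fintype ι]
    (D : Derivation K S S) (f : ι → S) (p : MvPolynomial ι K) :
    D (aeval f p) = ∑ i, aeval f (pderiv i p) * D (f i) := by
  classical
  induction p using MvPolynomial.induction_on with
  | C a => simp
  | add p q hp hq => simp only [map_add, hp, hq, add_mul, Finset.sum_add_distrib]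
  | mul_X p j hp =>
    simp only [map_mul, aeval_X, Derivation.leibniz, hp, pderiv_X, smul_eq_mul, map_add, add_mul,
      Finset.sum_add_distrib, Finset.mul_sum]
    congr 1
    · rw [Finset.sum_eq_single j]
      · simp
      · intro b _ hb
        simp [Pi.single_eq_of_ne hb.symm]
      · simp
    · exact Finset.sum_congr rfl fun i _ => by ring

theorem exists_eq_C_of_pderiv_eq_zero {ι K : Type*} [CommRing K] [IsDomain K] [CharZero K]
    {p : MvPolynomial ι K} (h : ∀ i, pderiv i p = 0) : ∃ c, p = C c := by
  classical
  refine ⟨coeff 0 p, ?_⟩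
  ext m
  rw [coeff_C]
  split_ifs with hm
  · rw [hm]
  · obtain ⟨i, hi⟩ : ∃ i, m i ≠ 0 := by
      by_contra! h0
      exact hm (Finsupp.ext fun i => by simp [h0 i])
    have h1 := congrArg (coeff (m - Finsupp.single i 1)) (h i)
    have h2 : m - Finsupp.single i 1 + Finsupp.single i 1 = m :=
      tsub_add_cancel_of_le (by simpa using Nat.one_le_iff_ne_zero.2 hi)
    rw [coeff_pderiv, h2, coeff_zero] at h1
    rcases mul_eq_zero.1 h1 with h3 | h3
    · exact h3
    · exact absurd h3 (Nat.cast_add_one_ne_zero _)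

theorem totalDegree_pderiv_lt {ι K : Type*} [CommRing K] (p : MvPolynomial ι K) (i : ι)
    (h : p.totalDegree ≠ 0) : (pderiv i p).totalDegree < p.totalDegree := by
  classical
  rw [totalDegree, Finset.sup_lt_iff (by simpa using Nat.pos_of_ne_zero h)]
  intro m hm
  have h1 : coeff (m + Finsupp.single i 1) p ≠ 0 := by
    intro h0
    rw [mem_support_iff, coeff_pderiv, h0, zero_mul] at hm
    exact hm rfl
  have h2 := le_totalDegree (mem_support_iff.2 h1)
  rw [Finsupp.sum_add_index' (by simp) (by simp), Finsupp.sum_single_index rfl] at h2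
  exact h2

/-- The Jacobian criterion for algebraic independence. -/
theorem algebraicIndependent_of_det_derivation_ne_zero {ι K S : Type*} [Field K] [CharZero K]
    [CommRing S] [IsDomain S] [Algebra K S] [Fintype ι] [DecidableEq ι]
    (f : ι → S) (D : ι → Derivation K S S)
    (h : (Matrix.of fun l k => D l (f k)).det ≠ 0) : AlgebraicIndependent K f := by
  rw [algebraicIndependent_iff]
  intro p
  induction hn : p.totalDegree using Nat.strong_induction_on generalizing p with
  | _ n ih =>
    intro hp
    -- Applying each `D l` to the relation `p` shows that the Jacobian matrix kills the gradient of
    -- `p`. Hence the partial derivatives are relations of smaller degree, zero by induction, and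
    -- `p` is constant.
    have hv : (fun k => aeval f (pderiv k p)) = 0 := by
      refine Matrix.eq_zero_of_mulVec_eq_zero h ?_
      ext l
      have := derivation_aeval (D l) f p
      rw [hp, map_zero] at this
      rw [Matrix.mulVec, dotProduct, Pi.zero_apply, this]
      exact Finset.sum_congr rfl fun k _ => mul_comm _ _
    have hc : ∃ c, p = C c := by
      by_cases h0 : p.totalDegree = 0
      · exact ⟨_, totalDegree_eq_zero_iff_eq_C.1 h0⟩
      · exact exists_eq_C_of_pderiv_eq_zero fun i =>
          ih _ (hn ▸ totalDegree_pderiv_lt p i h0) _ rfl (congrFun hv i)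
    obtain ⟨c, rfl⟩ := hc
    rw [aeval_C] at hp
    rw [(map_eq_zero_iff _ (FaithfulSMul.algebraMap_injective K S)).1 hp, C_0]

/-- An ideal of `K[σ]` that contains an irreducible polynomial `f` and no nonzero polynomial in
the variables other than `i` is generated by `f`. -/
theorem eq_span_singleton_of_irreducible {σ K : Type*} [Field K] (I : Ideal (MvPolynomial σ K))
    {f : MvPolynomial σ K} (hf : Irreducible f) (hfI : f ∈ I) (i : σ)
    (h : ∀ q : MvPolynomial {j // j ≠ i} K, rename (↑) q ∈ I → q = 0) :
    I = Ideal.span {f} := by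
  classical
  let S := MvPolynomial { j // j ≠ i } K
  let e : MvPolynomial σ K ≃ₐ[K] Polynomial S :=
    (renameEquiv K (Equiv.optionSubtypeNe i).symm).trans (optionEquivLeft K _)
  have he : ∀ q : S, e.symm (Polynomial.C q) = rename (↑) q := by
    have : e.symm.toAlgHom.comp Polynomial.CAlgHom = rename (↑) := by ext; simp [e, S]
    exact fun q => DFunLike.congr_fun this q
  refine le_antisymm (fun p hp => ?_) ((Ideal.span_singleton_le_iff_mem _).2 hfI)
  rw [Ideal.mem_span_singleton]
  by_contra hdvd
  have hf' : Irreducible (e f) := (MulEquiv.irreducible_iff e).2 hf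
  -- Otherwise `f` itself would be a polynomial in the other variables lying in `I`.
  have hdeg : (e f).natDegree ≠ 0 := by
    intro h0
    obtain ⟨c, hc⟩ := Polynomial.natDegree_eq_zero.1 h0
    have h1 : rename (↑) c = f := by rw [← he, hc, e.symm_apply_apply]
    rw [h c (h1 ▸ hfI), map_zero] at h1
    exact hf.ne_zero h1.symm
  have hprim := hf'.isPrimitive hdeg
  -- Gauss's lemma: `f` stays irreducible over the fraction field of `S`, so if `f ∤ p` there is a
  -- Bézout relation. Clearing denominators puts the nonzero element `b * c` of `S` into `I`.
  let _ : NormalizedGCDMonoid S := Classical.arbitrary _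
  let F := FractionRing S
  have hirr := (hprim.irreducible_iff_irreducible_map_fraction_map (K := F)).1 hf'
  have hdvd' : ¬ (e f).map (algebraMap S F) ∣ (e p).map (algebraMap S F) := by
    intro hd
    have h1 := hprim.dvd_of_fraction_map_dvd_fraction_map (K := F) hd
    exact hdvd ((map_dvd_iff e).1 h1)
  obtain ⟨u, v, huv⟩ := hirr.coprime_iff_not_dvd.2 hdvd'
  obtain ⟨b, hb, hu⟩ := IsLocalization.integerNormalization_spec (nonZeroDivisors S) u
  obtain ⟨c, hc, hv⟩ := IsLocalization.integerNormalization_spec (nonZeroDivisors S) v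
  set U := IsLocalization.integerNormalization (nonZeroDivisors S) u
  set V := IsLocalization.integerNormalization (nonZeroDivisors S) v
  have key : Polynomial.C (b * c) = Polynomial.C c * U * e f + Polynomial.C b * V * e p := by
    refine Polynomial.map_injective _ (IsFractionRing.injective S F) ?_
    simp only [Polynomial.map_add, Polynomial.map_mul, hu, hv, Polynomial.map_C, map_mul,
      Algebra.smul_def, Polynomial.algebraMap_apply]
    linear_combination (-Polynomial.C (algebraMap S F b) * Polynomial.C (algebraMap S F c)) * huv
  have hmem : rename (↑) (b * c) ∈ I := by
    rw [← he, key, map_add, map_mul, map_mul _ _ (e p), e.symm_apply_apply, e.symm_apply_apply]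
    exact I.add_mem (I.mul_mem_left _ hfI) (I.mul_mem_left _ hp)
  exact nonZeroDivisors.ne_zero (mul_mem hb hc) (h _ hmem)

/-- A polynomial is irreducible if its image under a linear substitution of the variables is
irreducible of the same total degree. -/
theorem irreducible_of_aeval {σ τ K : Type*} [Field K] (φ : σ → MvPolynomial τ K)
    (hφ : ∀ i, (φ i).totalDegree ≤ 1) {f : MvPolynomial σ K} (hf : Irreducible (aeval φ f))
    (hdeg : f.totalDegree ≤ (aeval φ f).totalDegree) : Irreducible f := by
  have hle : ∀ g : MvPolynomial σ K, (aeval φ g).totalDegree ≤ g.totalDegree := by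
    intro g
    rw [aeval_def, eval₂_eq]
    refine totalDegree_finsetSum_le fun d hd => ?_
    refine (totalDegree_mul _ _).trans ?_
    have h1 : (algebraMap K (MvPolynomial τ K) (coeff d g)).totalDegree = 0 := by
      rw [algebraMap_eq, totalDegree_C]
    rw [h1, zero_add]
    refine (totalDegree_finsetProd _ _).trans ((Finset.sum_le_sum fun i _ =>
      (totalDegree_pow _ _).trans (Nat.mul_le_mul_left _ (hφ i))).trans ?_)
    simpa [Finsupp.sum] using le_totalDegree hd
  -- The substitution raises no degree and preserves that of `f`, so it preserves the degree of
  -- every factor; a factor with unit image is therefore constant.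
  have hunit : ∀ g h : MvPolynomial σ K, f = g * h → IsUnit (aeval φ g) → IsUnit g := by
    intro g h hgh hu
    have hne : aeval φ g * aeval φ h ≠ 0 := by rw [← map_mul, ← hgh]; exact hf.ne_zero
    have hg : g ≠ 0 := by rintro rfl; simp at hne
    have hh : h ≠ 0 := by rintro rfl; simp at hne
    rw [hgh, map_mul, totalDegree_mul_of_isDomain hg hh,
      totalDegree_mul_of_isDomain (left_ne_zero_of_mul hne) (right_ne_zero_of_mul hne)] at hdeg
    have h0 := (isUnit_iff_totalDegree_of_isReduced.1 hu).2
    have h1 : g.totalDegree = 0 := by have := hle h; omega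
    rw [totalDegree_eq_zero_iff_eq_C.1 h1] at hg ⊢
    exact (IsUnit.mk0 _ (by rintro h; simp [h] at hg)).map C
  refine ⟨fun hu => hf.not_isUnit (hu.map _), fun g h hgh => ?_⟩
  rcases hf.isUnit_or_isUnit (by rw [hgh, map_mul]) with hu | hu
  · exact Or.inl (hunit g h hgh hu)
  · exact Or.inr (hunit h g (hgh.trans (mul_comm _ _)) hu)

/-- Every point of affine space has height equal to the dimension of the space. -/
theorem height_vanishingIdeal_singleton {σ K : Type*} [Field K] [IsAlgClosed K] [Finite σ]
    (x : σ → K) : (vanishingIdeal K {x}).height = (Nat.card σ : ℕ∞) := by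
  have hdim : ringKrullDim (MvPolynomial σ K) = ((Nat.card σ : ℕ∞) : WithBot ℕ∞) := by
    simp
  -- Translations are automorphisms, so all points have the same height. By the Nullstellensatz the
  -- supremum over maximal ideals, which is the dimension, is this common value.
  have key : ∀ y : σ → K, (vanishingIdeal K {y}).height = (vanishingIdeal K {x}).height := by
    intro y
    let e : MvPolynomial σ K ≃ₐ[K] MvPolynomial σ K :=
      AlgEquiv.ofAlgHom (aeval fun i => X i + C (x i - y i)) (aeval fun i => X i + C (y i - x i))
        (by ext1 i; simp; ring) (by ext1 i; simp; ring)
    have h1 : vanishingIdeal K {x} = (vanishingIdeal K {y}).comap (e : MvPolynomial σ K ≃+* MvPolynomial σ K) := by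
      ext p
      rw [Ideal.mem_comap, mem_vanishingIdeal_singleton_iff, mem_vanishingIdeal_singleton_iff]
      have h2 : (aeval y).comp e.toAlgHom = aeval (R := K) x := by ext i; simp [e]
      exact iff_of_eq (congrArg (· = 0) (DFunLike.congr_fun h2 p).symm)
    rw [h1]
    exact (RingEquiv.height_comap (e : MvPolynomial σ K ≃+* MvPolynomial σ K) _).symm
  have hsup := Ideal.sup_isMaximal_height_eq_ringKrullDim (R := MvPolynomial σ K)
  rw [hdim, WithBot.coe_inj] at hsup
  rw [← hsup]
  refine le_antisymm (le_iSup₂_of_le (vanishingIdeal K {x}) inferInstance le_rfl) ?_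
  refine iSup₂_le fun I hI => ?_
  obtain ⟨y, rfl⟩ := (isMaximal_iff_eq_vanishingIdeal_singleton (K := K)).1 hI
  exact (key y).le

/-- The dimension of a hypersurface. -/
theorem ringKrullDim_quotient_span_singleton_add_one {σ K : Type*} [Field K] [IsAlgClosed K]
    [Finite σ] {f : MvPolynomial σ K} (hf : f ≠ 0) {x : σ → K} (hx : aeval x f = 0) :
    ringKrullDim (MvPolynomial σ K ⧸ Ideal.span {f}) + 1 = Nat.card σ := by
  -- The point `x` provides a prime of full height containing `f`, so that the dimension drops by
  -- exactly one.
  have h := Module.ringKrullDim_quotient_add_one_of_mem_nonZeroDivisors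
    (mem_nonZeroDivisors_of_ne_zero hf) (p := vanishingIdeal K {x})
    (by rw [height_vanishingIdeal_singleton]; simp)
    ((mem_vanishingIdeal_singleton_iff x f).2 hx)
  simpa using h

end MvPolynomial

/-! ### States of the 4-cycle as traces of matrix products. -/

namespace TensorNetwork

section Network

theorem bondIdx_restrict_injective {V : Type} {Γ : SimpleGraph V} (m : Γ.edgeSet → ℕ) :
    Function.Injective fun (s : ∀ e : Γ.edgeSet, Fin (m e)) (i : V) (e : EdgeAt Γ i) => s e.1 := by
  intro s t h
  funext e
  obtain ⟨i, hi⟩ : ∃ i, i ∈ (e : Sym2 V) := ⟨_, Sym2.out_fst_mem _⟩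
  exact congrFun (congrFun h i) ⟨e, hi⟩

/-- The graph tensor contracts the bonds: a state is a sum over all assignments of basis vectors
to the edges. -/
theorem multiApply_graphTensor {V : Type} [Fintype V] [DecidableEq V] {Γ : SimpleGraph V}
    [DecidableRel Γ.Adj] (m : Γ.edgeSet → ℕ) {n : V → ℕ}
    (X : ∀ i, Matrix (Fin (n i)) (BondIdx Γ m i) ℂ) (v : ∀ i, Fin (n i)) :
    multiApply X (graphTensor m) v =
      ∑ s : ∀ e : Γ.edgeSet, Fin (m e), ∏ i, X i (v i) fun e => s e.1 := by
  classical
  rw [multiApply]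
  symm
  refine Finset.sum_of_injOn (fun s i e => s e.1) (bondIdx_restrict_injective m).injOn
    (by simp) ?_ ?_
  · intro w _ hw
    suffices h : graphTensor m w = 0 by rw [h, mul_zero]
    by_contra h0
    rw [graphTensor, ← ne_eq, Finset.prod_ne_zero_iff] at h0
    have h1 : ∀ (e : Γ.edgeSet) (i j : V) (hi : i ∈ (e : Sym2 V)) (hj : j ∈ (e : Sym2 V)),
        w i ⟨e, hi⟩ = w j ⟨e, hj⟩ := by
      intro e
      by_contra h2
      exact h0 e (Finset.mem_univ _) (if_neg h2)
    refine hw ⟨fun e => w _ ⟨e, Sym2.out_fst_mem _⟩, by simp, ?_⟩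
    funext i e
    exact h1 _ _ _ _ _
  · intro s _
    have : graphTensor m (fun i e => s e.1) = 1 :=
      Finset.prod_eq_one fun e _ => if_pos fun _ _ _ _ => rfl
    rw [this, mul_one]

end Network

section Cycle

/-- The matrix product `tr (A_0 A_1 A_2 A_3)`, as a function of the physical indices `k`. -/
def cycleState {R : Type*} [CommRing R] (A : Fin 4 → Fin 2 → Fin 2 → Fin 2 → R)
    (k : Fin 4 → Fin 2) : R :=
  ∑ p : Fin 2, ∑ q : Fin 2, ∑ r : Fin 2, ∑ s : Fin 2,
    A 0 (k 0) s p * A 1 (k 1) p q * A 2 (k 2) q r * A 3 (k 3) r s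

theorem map_cycleState {R S : Type*} [CommRing R] [CommRing S] (φ : R →+* S)
    (A : Fin 4 → Fin 2 → Fin 2 → Fin 2 → R) (k : Fin 4 → Fin 2) :
    φ (cycleState A k) = cycleState (fun i a p q => φ (A i a p q)) k := by
  simp [cycleState]

theorem sum_fin_four_fun {α M : Type*} [Fintype α] [AddCommMonoid M] (f : (Fin 4 → α) → M) :
    ∑ w, f w = ∑ a, ∑ b, ∑ c, ∑ d, f ![a, b, c, d] := by
  have h : ∀ {n : ℕ} (g : (Fin (n + 1) → α) → M),
      ∑ w, g w = ∑ a, ∑ w : Fin n → α, g (Matrix.vecCons a w) := by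
    intro n g
    rw [← (Fin.consEquiv fun _ => α).sum_comp, Fintype.sum_prod_type]
    rfl
  simp only [h, Finset.univ_unique, Finset.sum_singleton, Matrix.empty_eq]

/-- The edge `{i, i + 1}` of the cycle. -/
def cycleEdge (i : Fin 4) : (SimpleGraph.cycleGraph 4).edgeSet :=
  ⟨s(i, i + 1), by revert i; simp only [SimpleGraph.mem_edgeSet]; decide⟩

theorem cycleEdge_bijective : Function.Bijective cycleEdge := by
  constructor
  · intro i j h
    have h1 := congrArg Subtype.val h
    revert h1
    simp only [cycleEdge]
    revert i j
    decide
  · rintro ⟨e, he⟩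
    induction e using Sym2.ind with
    | _ x y =>
      have h1 : (SimpleGraph.cycleGraph 4).Adj x y := he
      have h2 : ∃ i : Fin 4, s(i, i + 1) = s(x, y) := by
        clear he
        revert x y
        decide
      obtain ⟨i, hi⟩ := h2
      exact ⟨i, Subtype.ext hi⟩

theorem mem_cycleEdge (i : Fin 4) : i ∈ (cycleEdge i : Sym2 (Fin 4)) := by
  simp [cycleEdge]

theorem mem_cycleEdge_sub_one (i : Fin 4) : i ∈ (cycleEdge (i - 1) : Sym2 (Fin 4)) := by
  simp [cycleEdge]

theorem eq_of_mem_cycleEdge {i j : Fin 4} (h : i ∈ (cycleEdge j : Sym2 (Fin 4))) :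
    j = i ∨ j = i - 1 := by
  simp only [cycleEdge, Sym2.mem_iff] at h
  rcases h with rfl | rfl <;> simp

/-- Orientation convention: at vertex `i`, rows are indexed by the edge `{i - 1, i}` and columns by
the edge `{i, i + 1}`. -/
theorem cycleState_eq_multiApply
    (X : ∀ i, Matrix (Fin 2) (BondIdx (SimpleGraph.cycleGraph 4) (fun _ => 2) i) ℂ)
    (A : Fin 4 → Fin 2 → Fin 2 → Fin 2 → ℂ)
    (h : ∀ i a (s : (SimpleGraph.cycleGraph 4).edgeSet → Fin 2),
      X i a (fun e => s e.1) = A i a (s (cycleEdge (i - 1))) (s (cycleEdge i))) :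
    multiApply X (graphTensor fun _ => 2) = cycleState A := by
  funext k
  rw [multiApply_graphTensor]
  simp only [h]
  rw [← ((Equiv.ofBijective _ cycleEdge_bijective).arrowCongr (Equiv.refl (Fin 2))).sum_comp]
  have h1 : ∀ (w : Fin 4 → Fin 2) (i : Fin 4),
      ((Equiv.ofBijective _ cycleEdge_bijective).arrowCongr (Equiv.refl (Fin 2))) w (cycleEdge i)
        = w i := by
    intro w i
    simp only [Equiv.arrowCongr_apply, Function.comp, Equiv.coe_refl, id]
    exact congrArg w (Equiv.ofBijective_symm_apply_apply _ cycleEdge_bijective i)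
  simp only [h1]
  rw [sum_fin_four_fun, cycleState]
  simp only [Fin.prod_univ_four]
  rfl

theorem tensorNetworkStates_cycle :
    tensorNetworkStates (Γ := SimpleGraph.cycleGraph 4) (fun _ => 2) (fun _ => 2) =
      Set.range (cycleState (R := ℂ)) := by
  apply Set.Subset.antisymm
  · rintro _ ⟨X, rfl⟩
    refine ⟨fun i a p q => X i a fun e => if e.1 = cycleEdge i then q else p, ?_⟩
    symm
    refine cycleState_eq_multiApply _ _ fun i a s => congrArg (X i a) (funext fun e => ?_)
    obtain ⟨e, hi⟩ := e
    obtain ⟨j, rfl⟩ := cycleEdge_bijective.2 e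
    rcases eq_of_mem_cycleEdge hi with rfl | rfl
    · simp
    · rw [if_neg]
      intro h
      have := cycleEdge_bijective.1 h
      revert this
      clear hi h
      revert i
      decide
  · rintro _ ⟨A, rfl⟩
    refine ⟨fun i a w => A i a (w ⟨cycleEdge (i - 1), mem_cycleEdge_sub_one i⟩)
      (w ⟨cycleEdge i, mem_cycleEdge i⟩), ?_⟩
    exact cycleState_eq_multiApply _ _ fun i a s => rfl

end Cycle

end TensorNetwork

namespace TensorNetwork

open MvPolynomial

/-! ### The invariant in coordinates. -/

section Invariant

variable {R S : Type} [CommRing R] [CommRing S]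

/-- The determinant of the slice `(T_{a b c d})_{b, d}`. -/
def sliceDet (T : (Fin 4 → Fin 2) → R) (a c : Fin 2) : R :=
  T ![a, 0, c, 0] * T ![a, 1, c, 1] - T ![a, 0, c, 1] * T ![a, 1, c, 0]

/-- The polarization of the determinant at two slices of `T`. -/
def slicePolar (T : (Fin 4 → Fin 2) → R) (a c a' c' : Fin 2) : R :=
  T ![a, 0, c, 0] * T ![a', 1, c', 1] + T ![a, 1, c, 1] * T ![a', 0, c', 0]
    - T ![a, 0, c, 1] * T ![a', 1, c', 0] - T ![a, 1, c, 0] * T ![a', 0, c', 1]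

/-- The matrix of `F(T)`, in terms of the coordinates of `T`. -/
def sliceMatrix (T : (Fin 4 → Fin 2) → R) : Matrix (Fin 3) (Fin 3) R :=
  !![sliceDet T 0 0, slicePolar T 0 0 0 1, sliceDet T 0 1;
     slicePolar T 0 0 1 0, slicePolar T 0 0 1 1 + slicePolar T 0 1 1 0, slicePolar T 0 1 1 1;
     sliceDet T 1 0, slicePolar T 1 0 1 1, sliceDet T 1 1]

theorem monomial_biquadraticExponent (r s : Fin 3) (c : R) :
    monomial (biquadraticExponent r s) c =
      C c * (X (Sum.inl 0) ^ (2 - (r : ℕ)) * X (Sum.inl 1) ^ (r : ℕ) *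
        (X (Sum.inr 0) ^ (2 - (s : ℕ)) * X (Sum.inr 1) ^ (s : ℕ))) := by
  simp only [X_pow_eq_monomial, monomial_mul, C_mul_monomial, mul_one, biquadraticExponent]

theorem biquadraticExponent_injective {r s r' s' : Fin 3}
    (h : biquadraticExponent r s = biquadraticExponent r' s') : r = r' ∧ s = s' := by
  have h1 := DFunLike.congr_fun h (Sum.inl 1)
  have h2 := DFunLike.congr_fun h (Sum.inr 1)
  simp [biquadraticExponent] at h1 h2
  exact ⟨Fin.ext h1, Fin.ext h2⟩

theorem biquadraticForm_eq_sum (T : (Fin 4 → Fin 2) → R) :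
    biquadraticForm T = ∑ r, ∑ s, monomial (biquadraticExponent r s) (sliceMatrix T r s) := by
  simp only [monomial_biquadraticExponent, biquadraticForm, pencil, Matrix.det_fin_two,
    Matrix.of_apply, Fin.sum_univ_two, Fin.sum_univ_three]
  simp [sliceMatrix, sliceDet, slicePolar]
  ring

theorem biquadraticMatrix_eq (T : (Fin 4 → Fin 2) → R) : biquadraticMatrix T = sliceMatrix T := by
  ext r s
  rw [biquadraticMatrix, Matrix.of_apply, biquadraticForm_eq_sum, coeff_sum,
    Finset.sum_eq_single r, coeff_sum, Finset.sum_eq_single s, coeff_monomial, if_pos rfl]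
  · intro s' _ hs
    rw [coeff_monomial, if_neg fun h => hs (biquadraticExponent_injective h).2]
  · simp
  · intro r' _ hr
    rw [coeff_sum]
    exact Finset.sum_eq_zero fun s' _ => by
      rw [coeff_monomial, if_neg fun h => hr (biquadraticExponent_injective h).1]
  · simp

theorem map_det_sliceMatrix (φ : R →+* S) (T : (Fin 4 → Fin 2) → R) :
    φ (sliceMatrix T).det = (sliceMatrix fun k => φ (T k)).det := by
  simp [sliceMatrix, sliceDet, slicePolar, Matrix.det_fin_three]

theorem aeval_invariantSix {A : Type} [CommRing A] [Algebra ℂ A] (T : (Fin 4 → Fin 2) → A) :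
    aeval T invariantSix = (sliceMatrix T).det := by
  rw [invariantSix, biquadraticMatrix_eq]
  simpa using map_det_sliceMatrix (aeval (R := ℂ) T).toRingHom X

theorem eval_invariantSix (T : (Fin 4 → Fin 2) → ℂ) :
    eval T invariantSix = (sliceMatrix T).det := by
  rw [← aeval_invariantSix, aeval_eq_eval]

theorem isHomogeneous_invariantSix : invariantSix.IsHomogeneous 6 := by
  rw [invariantSix, biquadraticMatrix_eq, Matrix.det_apply]
  have hX : ∀ i j, (X i * X j : MvPolynomial (Fin 4 → Fin 2) ℂ).IsHomogeneous 2 :=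
    fun i j => (isHomogeneous_X ℂ i).mul (isHomogeneous_X ℂ j)
  have hdet : ∀ a c, (sliceDet (X : _ → MvPolynomial (Fin 4 → Fin 2) ℂ) a c).IsHomogeneous 2 :=
    fun a c => by
      unfold sliceDet
      exact (hX _ _).sub (hX _ _)
  have hpol : ∀ a c a' c',
      (slicePolar (X : _ → MvPolynomial (Fin 4 → Fin 2) ℂ) a c a' c').IsHomogeneous 2 :=
    fun a c a' c' => by
      unfold slicePolar
      exact (((hX _ _).add (hX _ _)).sub (hX _ _)).sub (hX _ _)
  have hentry : ∀ r s,
      (sliceMatrix (X : _ → MvPolynomial (Fin 4 → Fin 2) ℂ) r s).IsHomogeneous 2 := by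
    intro r s
    fin_cases r <;> fin_cases s <;>
      simp [sliceMatrix, hdet, hpol, (hpol _ _ _ _).add (hpol _ _ _ _)]
  refine IsHomogeneous.sum _ _ _ fun σ _ => ?_
  have hprod := IsHomogeneous.prod Finset.univ
    (fun i => sliceMatrix (X : _ → MvPolynomial (Fin 4 → Fin 2) ℂ) (σ i) i) (fun _ => 2)
    fun i _ => hentry _ _
  rcases Int.units_eq_one_or (Equiv.Perm.sign σ) with h | h
  · simpa [h] using hprod
  · simpa [h] using hprod.neg

end Invariant

/-! ### Invariance under the four linear groups. -/

section Invariance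

variable {R : Type} [CommRing R]

/-- The action of a `2 × 2` matrix on the coefficients of binary quadratic forms. -/
def symSquare (g : Matrix (Fin 2) (Fin 2) R) : Matrix (Fin 3) (Fin 3) R :=
  !![g 0 0 ^ 2, g 0 0 * g 0 1, g 0 1 ^ 2;
     2 * g 0 0 * g 1 0, g 0 0 * g 1 1 + g 0 1 * g 1 0, 2 * g 0 1 * g 1 1;
     g 1 0 ^ 2, g 1 0 * g 1 1, g 1 1 ^ 2]

theorem det_symSquare (g : Matrix (Fin 2) (Fin 2) R) : (symSquare g).det = g.det ^ 3 := by
  simp only [symSquare, Matrix.det_fin_three, Matrix.det_fin_two]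
  simp
  ring

variable (g : Matrix (Fin 2) (Fin 2) R) {T T' : (Fin 4 → Fin 2) → R}

/-- The first factor substitutes linearly in `x`, so it multiplies the coefficient matrix by the
symmetric square of `g`. The third does the same for `y`, on the other side. -/
theorem det_sliceMatrix_act_zero
    (h : ∀ a b c d, T' ![a, b, c, d] = ∑ x, g a x * T ![x, b, c, d]) :
    (sliceMatrix T').det = g.det ^ 3 * (sliceMatrix T).det := by
  have : sliceMatrix T' = symSquare g * sliceMatrix T := by
    ext r s
    fin_cases r <;> fin_cases s <;>
    · simp [sliceMatrix, symSquare, sliceDet, slicePolar, h, Matrix.mul_apply, Fin.sum_univ_three]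
      ring
  rw [this, Matrix.det_mul, det_symSquare]

theorem det_sliceMatrix_act_two
    (h : ∀ a b c d, T' ![a, b, c, d] = ∑ x, g c x * T ![a, b, x, d]) :
    (sliceMatrix T').det = g.det ^ 3 * (sliceMatrix T).det := by
  have : sliceMatrix T' = sliceMatrix T * (symSquare g).transpose := by
    ext r s
    fin_cases r <;> fin_cases s <;>
    · simp [sliceMatrix, symSquare, sliceDet, slicePolar, h, Matrix.mul_apply, Fin.sum_univ_three]
      ring
  rw [this, Matrix.det_mul, Matrix.det_transpose, det_symSquare, mul_comm]

/-- The second factor acts on the rows of every slice, the fourth on the columns; either scales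
`F(T)` by `g.det`, hence a `3 × 3` determinant by its cube. -/
theorem det_sliceMatrix_act_one
    (h : ∀ a b c d, T' ![a, b, c, d] = ∑ x, g b x * T ![a, x, c, d]) :
    (sliceMatrix T').det = g.det ^ 3 * (sliceMatrix T).det := by
  have : sliceMatrix T' = g.det • sliceMatrix T := by
    ext r s
    fin_cases r <;> fin_cases s <;>
    · simp [sliceMatrix, sliceDet, slicePolar, h, Matrix.det_fin_two]
      ring
  rw [this, Matrix.det_smul, Fintype.card_fin]

theorem det_sliceMatrix_act_three
    (h : ∀ a b c d, T' ![a, b, c, d] = ∑ x, g d x * T ![a, b, c, x]) :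
    (sliceMatrix T').det = g.det ^ 3 * (sliceMatrix T).det := by
  have : sliceMatrix T' = g.det • sliceMatrix T := by
    ext r s
    fin_cases r <;> fin_cases s <;>
    · simp [sliceMatrix, sliceDet, slicePolar, h, Matrix.det_fin_two]
      ring
  rw [this, Matrix.det_smul, Fintype.card_fin]

theorem det_sliceMatrix_multiApply (g : Fin 4 → Matrix (Fin 2) (Fin 2) ℂ)
    (T : (Fin 4 → Fin 2) → ℂ) :
    (sliceMatrix (multiApply g T)).det = (∏ i, (g i).det) ^ 3 * (sliceMatrix T).det := by
  let T₃ : (Fin 4 → Fin 2) → ℂ := fun v => ∑ x, g 3 (v 3) x * T ![v 0, v 1, v 2, x]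
  let T₂ : (Fin 4 → Fin 2) → ℂ := fun v => ∑ x, g 2 (v 2) x * T₃ ![v 0, v 1, x, v 3]
  let T₁ : (Fin 4 → Fin 2) → ℂ := fun v => ∑ x, g 1 (v 1) x * T₂ ![v 0, x, v 2, v 3]
  have h₀ : ∀ a b c d, multiApply g T ![a, b, c, d] = ∑ x, g 0 a x * T₁ ![x, b, c, d] := by
    intro a b c d
    rw [multiApply, sum_fin_four_fun]
    simp only [T₁, T₂, T₃, Finset.mul_sum, Fin.prod_univ_four]
    refine Finset.sum_congr rfl fun x _ => Finset.sum_congr rfl fun y _ =>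
      Finset.sum_congr rfl fun z _ => Finset.sum_congr rfl fun w _ => ?_
    simp only [Matrix.cons_val]
    ring
  rw [det_sliceMatrix_act_zero (g 0) h₀,
    det_sliceMatrix_act_one (T := T₂) (g 1) fun a b c d => rfl,
    det_sliceMatrix_act_two (T := T₃) (g 2) fun a b c d => rfl,
    det_sliceMatrix_act_three (T := T) (g 3) fun a b c d => rfl, Fin.prod_univ_four]
  ring

end Invariance

/-! ### Vanishing on the states of the cycle. -/

section Vanishing

variable {R : Type} [CommRing R]

/-- The value of `F(T)` at `x` and `y`. -/
def sliceForm (T : (Fin 4 → Fin 2) → R) (x y : Fin 2 → R) : R :=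
  (Matrix.of fun b d => ∑ a, ∑ c, x a * y c * T ![a, b, c, d]).det

/-- A binary quadratic form is determined by its values at `(1,0)`, `(1,1)`, `(0,1)`: the middle
coefficient is `f(1,1) - f(1,0) - f(0,1)`. This change of basis has determinant 1. -/
theorem det_sliceMatrix_eq_interpolation (T : (Fin 4 → Fin 2) → R) {p : Fin 3 → Fin 2 → R}
    (h₀ : p 0 = ![1, 0]) (h₁ : p 1 = ![1, 1]) (h₂ : p 2 = ![0, 1]) :
    (sliceMatrix T).det = (Matrix.of fun i j => sliceForm T (p i) (p j)).det := by
  have h1 : sliceMatrix T = !![1, 0, 0; -1, 1, -1; 0, 0, 1] *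
      (Matrix.of fun i j => sliceForm T (p i) (p j)) *
        (!![1, 0, 0; -1, 1, -1; 0, 0, 1] : Matrix (Fin 3) (Fin 3) R).transpose := by
    ext r s
    simp only [Matrix.mul_apply, Fin.sum_univ_three, Matrix.transpose_apply, Matrix.of_apply,
      h₀, h₁, h₂]
    fin_cases r <;> fin_cases s <;>
    · simp [sliceMatrix, sliceDet, slicePolar, sliceForm, Matrix.det_fin_two]
      try ring
  have h2 : (!![1, 0, 0; -1, 1, -1; 0, 0, 1] : Matrix (Fin 3) (Fin 3) R).det = 1 := by
    simp [Matrix.det_fin_three]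
  rw [h1, Matrix.det_mul, Matrix.det_mul, Matrix.det_transpose, h2, one_mul, mul_one]

/-- `det (tr (P B_b Q D_d))_{b, d}`. -/
def traceForm (B D : Fin 2 → Fin 2 → Fin 2 → R) (P Q : Fin 2 → Fin 2 → R) : R :=
  (Matrix.of fun b d => ∑ p, ∑ q, ∑ r, ∑ s, P s p * B b p q * Q q r * D d r s).det

/-- The coefficients of the binary quadratic form `det (B_0 u, B_1 u)`. -/
def pencilCoeff (B : Fin 2 → Fin 2 → Fin 2 → R) : Fin 3 → R :=
  ![B 0 0 0 * B 1 1 0 - B 0 1 0 * B 1 0 0,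
    B 0 0 0 * B 1 1 1 + B 0 0 1 * B 1 1 0 - B 0 1 0 * B 1 0 1 - B 0 1 1 * B 1 0 0,
    B 0 0 1 * B 1 1 1 - B 0 1 1 * B 1 0 1]

/-- A quadratic form in `Q` that takes the value `det (B_0 u, B_1 u) * det (Dᵀ_0 v, Dᵀ_1 v)` at
`Q = u vᵀ`. -/
def pencilProduct (B D : Fin 2 → Fin 2 → Fin 2 → R) (Q : Fin 2 → Fin 2 → R) : R :=
  let β := pencilCoeff B
  let δ := pencilCoeff fun d p q => D d q p
  β 0 * (δ 0 * Q 0 0 ^ 2 + δ 1 * (Q 0 0 * Q 0 1) + δ 2 * Q 0 1 ^ 2) +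
    β 1 * (δ 0 * (Q 0 0 * Q 1 0) + δ 1 * (Q 0 0 * Q 1 1) + δ 2 * (Q 0 1 * Q 1 1)) +
    β 2 * (δ 0 * Q 1 0 ^ 2 + δ 1 * (Q 1 0 * Q 1 1) + δ 2 * Q 1 1 ^ 2)

/-- The decomposition of `det (tr (P B_b Q D_d))` along
`Λ²(U ⊗ W) = S²U ⊗ Λ²W ⊕ Λ²U ⊗ S²W`. -/
theorem traceForm_eq (B D : Fin 2 → Fin 2 → Fin 2 → R) (P Q : Fin 2 → Fin 2 → R) :
    traceForm B D P Q =
      (traceForm B D P (1 : Matrix (Fin 2) (Fin 2) R) -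
        (P 0 0 * P 1 1 - P 0 1 * P 1 0) * pencilProduct B D (1 : Matrix (Fin 2) (Fin 2) R)) *
          (Q 0 0 * Q 1 1 - Q 0 1 * Q 1 0) +
      (P 0 0 * P 1 1 - P 0 1 * P 1 0) * pencilProduct B D Q := by
  -- The coefficient of `det Q` in the statement is the one forced by setting `Q = 1`.
  simp [traceForm, pencilProduct, pencilCoeff, Matrix.det_fin_two, Fin.sum_univ_two]
  ring

theorem sliceForm_cycleState (A : Fin 4 → Fin 2 → Fin 2 → Fin 2 → R) (x y : Fin 2 → R) :
    sliceForm (cycleState A) x y =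
      traceForm (A 1) (A 3) (fun s p => ∑ a, x a * A 0 a s p)
        (fun q r => ∑ c, y c * A 2 c q r) := by
  rw [sliceForm, traceForm]
  congr 1
  ext b d
  simp only [Matrix.of_apply, cycleState, Fin.sum_univ_two, Matrix.cons_val]
  ring

/-- By `traceForm_eq`, the matrix of values is a sum of two matrices of rank at most one. -/
theorem det_sliceMatrix_cycleState (A : Fin 4 → Fin 2 → Fin 2 → Fin 2 → R) :
    (sliceMatrix (cycleState A)).det = 0 := by
  rw [det_sliceMatrix_eq_interpolation _ (p := ![![1, 0], ![1, 1], ![0, 1]]) rfl rfl rfl]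
  simp only [sliceForm_cycleState]
  rw [Matrix.det_fin_three]
  simp only [Matrix.of_apply, traceForm_eq (A 1) (A 3) _ (fun q r => ∑ c, _ * A 2 c q r)]
  ring

end Vanishing

/-! ### Irreducibility of the invariant. -/

section Irreducible

/-- A substitution of variables under which `I_6` stays irreducible. -/
noncomputable def irreducibilitySpecialization (k : Fin 4 → Fin 2) : MvPolynomial (Fin 4) ℂ :=
  (![![![![0, X 2], ![0, X 0]], ![![X 2, X 3], ![X 0, X 2]]],
    ![![![0, X 0], ![X 1, 0]], ![![X 0, X 2], ![0, 0]]]] :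
      Fin 2 → Fin 2 → Fin 2 → Fin 2 → MvPolynomial (Fin 4) ℂ) (k 0) (k 1) (k 2) (k 3)

theorem aeval_irreducibilitySpecialization_invariantSix :
    aeval irreducibilitySpecialization invariantSix =
      -(X 0 ^ 4 * X 1) * X 3 +
        (X 2 ^ 4 * X 1 ^ 2 + 4 * (X 2 ^ 2 * X 0 ^ 3 * X 1) + 2 * X 0 ^ 6) := by
  rw [aeval_invariantSix, Matrix.det_fin_three]
  simp [sliceMatrix, sliceDet, slicePolar, irreducibilitySpecialization]
  ring

theorem not_X_dvd_of_eval_ne_zero {σ K : Type*} [Field K] {f : MvPolynomial σ K} (i : σ)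
    (x : σ → K) (hx : x i = 0) (h : eval x f ≠ 0) : ¬ X i ∣ f := by
  rintro ⟨g, rfl⟩
  simp [hx] at h

theorem irreducible_specialized_invariantSix :
    Irreducible (aeval irreducibilitySpecialization invariantSix) := by
  rw [aeval_irreducibilitySpecialization_invariantSix]
  have hvars : ∀ p ∈ supported ℂ ({3}ᶜ : Set (Fin 4)), 3 ∉ p.vars :=
    fun p hp h => mem_supported.1 hp h rfl
  have hX : ∀ i : Fin 4, i ≠ 3 → (X i : MvPolynomial (Fin 4) ℂ) ∈ supported ℂ ({3}ᶜ : Set (Fin 4)) :=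
    fun i hi => X_mem_supported.2 hi
  -- The polynomial has degree one in `X 3`. Its two coefficients are coprime: the constant one
  -- becomes `X 2 ^ 4 * X 1 ^ 2` at `X 0 = 0` and `2 * X 0 ^ 6` at `X 1 = 0`.
  refine irreducible_mul_X_add _ _ _ ?_ ?_ ?_ ?_
  · exact neg_ne_zero.2 (mul_ne_zero (pow_ne_zero _ (X_ne_zero _)) (X_ne_zero _))
  · refine hvars _ (neg_mem (mul_mem (pow_mem (hX 0 ?_) _) (hX 1 ?_))) <;> decide
  · refine hvars _ (add_mem (add_mem (mul_mem (pow_mem (hX 2 ?_) _) (pow_mem (hX 1 ?_) _))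
      (mul_mem (ofNat_mem _ _) (mul_mem (mul_mem (pow_mem (hX 2 ?_) _) (pow_mem (hX 0 ?_) _))
        (hX 1 ?_)))) (mul_mem (ofNat_mem _ _) (pow_mem (hX 0 ?_) _))) <;> decide
  · refine IsRelPrime.neg_left (IsRelPrime.mul_left (IsRelPrime.pow_left ?_) ?_)
    · refine (X_prime.irreducible.isRelPrime_iff_not_dvd).2
        (not_X_dvd_of_eval_ne_zero 0 ![0, 1, 1, 0] rfl ?_)
      simp
    · refine (X_prime.irreducible.isRelPrime_iff_not_dvd).2
        (not_X_dvd_of_eval_ne_zero 1 ![1, 0, 1, 0] rfl ?_)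
      simp

theorem isHomogeneous_irreducibilitySpecialization (k : Fin 4 → Fin 2) :
    (irreducibilitySpecialization k).IsHomogeneous 1 := by
  have h : ∀ a b c d, (irreducibilitySpecialization ![a, b, c, d]).IsHomogeneous 1 := by
    intro a b c d
    fin_cases a <;> fin_cases b <;> fin_cases c <;> fin_cases d <;>
      first | exact isHomogeneous_X _ _ | exact isHomogeneous_zero _ _ _
  exact h (k 0) (k 1) (k 2) (k 3)

theorem irreducible_invariantSix : Irreducible invariantSix := by
  have hirr := irreducible_specialized_invariantSix
  refine irreducible_of_aeval _
    (fun k => (isHomogeneous_irreducibilitySpecialization k).totalDegree_le) hirr ?_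
  rw [(isHomogeneous_invariantSix.aeval _ isHomogeneous_irreducibilitySpecialization).totalDegree
    hirr.ne_zero]
  exact isHomogeneous_invariantSix.totalDegree_le

end Irreducible

end TensorNetwork

namespace TensorNetwork

open MvPolynomial

/-! ### The tangent space at an integral point. -/

section Tangent

/-- The derivative of `cycleState` at `A` in the direction `B`. -/
def cycleStateDeriv {R : Type*} [CommRing R] (A B : Fin 4 → Fin 2 → Fin 2 → Fin 2 → R)
    (k : Fin 4 → Fin 2) : R :=
  ∑ p : Fin 2, ∑ q : Fin 2, ∑ r : Fin 2, ∑ s : Fin 2,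
    (B 0 (k 0) s p * A 1 (k 1) p q * A 2 (k 2) q r * A 3 (k 3) r s +
      A 0 (k 0) s p * B 1 (k 1) p q * A 2 (k 2) q r * A 3 (k 3) r s +
      A 0 (k 0) s p * A 1 (k 1) p q * B 2 (k 2) q r * A 3 (k 3) r s +
      A 0 (k 0) s p * A 1 (k 1) p q * A 2 (k 2) q r * B 3 (k 3) r s)

theorem derivation_cycleState {K R : Type*} [CommRing K] [CommRing R] [Algebra K R]
    (D : Derivation K R R) (A : Fin 4 → Fin 2 → Fin 2 → Fin 2 → R) (k : Fin 4 → Fin 2) :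
    D (cycleState A k) = cycleStateDeriv A (fun i a p q => D (A i a p q)) k := by
  simp only [cycleState, cycleStateDeriv, map_sum, Derivation.leibniz, smul_eq_mul]
  refine Finset.sum_congr rfl fun p _ => Finset.sum_congr rfl fun q _ =>
    Finset.sum_congr rfl fun r _ => Finset.sum_congr rfl fun s _ => ?_
  ring

theorem map_cycleStateDeriv {R S : Type*} [CommRing R] [CommRing S] (φ : R →+* S)
    (A B : Fin 4 → Fin 2 → Fin 2 → Fin 2 → R) (k : Fin 4 → Fin 2) :
    φ (cycleStateDeriv A B k) =
      cycleStateDeriv (fun i a p q => φ (A i a p q)) (fun i a p q => φ (B i a p q)) k := by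
  simp only [cycleStateDeriv, map_sum, map_add, map_mul]

/-- The matrices of a smooth point of the variety. -/
def smoothPoint : Fin 4 → Fin 2 → Fin 2 → Fin 2 → ℤ :=
  ![![![![0, 1], ![0, 0]], ![![1, 1], ![1, 0]]], ![![![0, 0], ![1, 1]], ![![1, 1], ![0, 1]]],
    ![![![0, 1], ![0, 0]], ![![0, 0], ![1, 0]]], ![![![0, 0], ![1, 0]], ![![1, 0], ![0, 1]]]]

/-- The tangent direction that changes the entry `(p, q)` of the matrix `a` at the vertex `i`. -/
def unitDirection (i : Fin 4) (a p q : Fin 2) : Fin 4 → Fin 2 → Fin 2 → Fin 2 → ℤ :=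
  fun i' a' p' q' => if i = i' ∧ a = a' ∧ p = p' ∧ q = q' then 1 else 0

/-- Tangent directions at `smoothPoint` along which the coordinates other than the one at
`(1, 0, 1, 0)` change one at a time. -/
def tangentDirection (a b c d : Fin 2) : Fin 4 → Fin 2 → Fin 2 → Fin 2 → ℤ :=
  let e := unitDirection
  let u := e 1 0 1 0 + e 1 0 1 1 - e 1 0 0 0 + e 0 1 1 1 - e 1 0 0 1 - e 0 0 0 1
  ![![![![e 1 0 1 0 - e 1 0 0 0 + e 0 1 1 1, e 0 0 1 1],
        ![e 2 1 0 1 + e 1 1 1 0 - e 3 0 0 1 - e 0 1 0 0 - e 0 0 0 0 - u, e 1 0 1 1 - e 1 0 0 1]],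
      ![![e 0 0 0 0 + u, e 0 0 1 0],
        ![e 2 1 1 1 - e 2 1 0 1 - e 3 0 0 1, -u]]],
    ![![![e 1 0 0 0 - e 0 1 1 1, e 0 1 1 1], ![0, e 1 0 0 1]],
      ![![e 1 1 1 0 - e 0 0 0 0 - u, e 0 0 0 0 - e 1 1 1 0 + e 1 1 0 0 + u],
        ![e 3 0 0 1, e 0 0 0 0 - e 1 1 1 0 + e 0 1 0 0 + u]]]] a b c d

/-- With these directions the relevant `15 × 15` Jacobian minor is the identity matrix, over `ℤ` and
thus decidable. The entry of `tangentDirection` at the omitted index is a placeholder. -/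
theorem cycleStateDeriv_tangentDirection : ∀ a b c d a' b' c' d' : Fin 2,
    (a, b, c, d) ≠ (1, 0, 1, 0) → (a', b', c', d') ≠ (1, 0, 1, 0) →
    cycleStateDeriv smoothPoint (tangentDirection a b c d) ![a', b', c', d'] =
      if (a, b, c, d) = (a', b', c', d') then 1 else 0 := by
  decide +kernel

/-- The coordinates of the generic cycle state other than the one at `(1, 0, 1, 0)` are
algebraically independent. -/
theorem algebraicIndependent_cycleState :
    AlgebraicIndependent ℂ fun k : {k : Fin 4 → Fin 2 // k ≠ ![1, 0, 1, 0]} =>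
      cycleState (fun i a p q => (X (i, a, p, q) :
        MvPolynomial (Fin 4 × Fin 2 × Fin 2 × Fin 2) ℂ)) k := by
  -- The derivations have constant coefficients. The determinant is a nonzero polynomial because its
  -- value at `smoothPoint` is 1.
  refine algebraicIndependent_of_det_derivation_ne_zero _ (fun l => mkDerivation ℂ fun j =>
    C (tangentDirection (l.1 0) (l.1 1) (l.1 2) (l.1 3) j.1 j.2.1 j.2.2.1 j.2.2.2 : ℂ)) ?_
  intro h
  have h1 := congrArg (eval fun j : Fin 4 × Fin 2 × Fin 2 × Fin 2 =>
    (smoothPoint j.1 j.2.1 j.2.2.1 j.2.2.2 : ℂ)) h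
  rw [map_zero, RingHom.map_det] at h1
  refine one_ne_zero ((Matrix.det_one (n := {k : Fin 4 → Fin 2 // k ≠ ![1, 0, 1, 0]})
    (R := ℂ)).symm.trans (Eq.trans (congrArg Matrix.det ?_) h1))
  have hvec : ∀ k : Fin 4 → Fin 2, k = ![k 0, k 1, k 2, k 3] := fun k => by
    ext i; fin_cases i <;> rfl
  ext ⟨l, hl⟩ ⟨k, hk⟩
  have hne : ∀ k : Fin 4 → Fin 2, k ≠ ![1, 0, 1, 0] → (k 0, k 1, k 2, k 3) ≠ (1, 0, 1, 0) := by
    intro k hk h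
    simp only [Prod.mk.injEq] at h
    exact hk (by rw [hvec k, h.1, h.2.1, h.2.2.1, h.2.2.2])
  have h2 := cycleStateDeriv_tangentDirection _ _ _ _ _ _ _ _ (hne l hl) (hne k hk)
  rw [← hvec k] at h2
  simp only [RingHom.mapMatrix_apply, Matrix.map_apply, Matrix.of_apply, derivation_cycleState,
    mkDerivation_X, map_cycleStateDeriv, eval_X, eval_C]
  have h3 := map_cycleStateDeriv (Int.castRingHom ℂ) smoothPoint
    (tangentDirection (l 0) (l 1) (l 2) (l 3)) k
  rw [h2] at h3
  refine Eq.trans ?_ h3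
  by_cases hlk : l = k
  · subst hlk
    simp
  · rw [if_neg, map_zero, Matrix.one_apply_ne (by simpa using hlk)]
    intro h
    simp only [Prod.mk.injEq] at h
    exact hlk (by rw [hvec l, hvec k, h.1, h.2.1, h.2.2.1, h.2.2.2])

end Tangent

/-! ### The ideal and the dimension of the variety. -/

theorem vanishingIdeal_range_cycleState :
    vanishingIdeal ℂ (Set.range (cycleState (R := ℂ))) = Ideal.span {invariantSix} := by
  refine eq_span_singleton_of_irreducible _ irreducible_invariantSix ?_ ![1, 0, 1, 0] ?_
  · rw [mem_vanishingIdeal_iff]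
    rintro _ ⟨A, rfl⟩
    rw [aeval_invariantSix, det_sliceMatrix_cycleState]
  · intro q hq
    refine algebraicIndependent_iff.1 algebraicIndependent_cycleState q ?_
    -- A polynomial in the 32 matrix entries is zero if it vanishes at every point, that is, on
    -- every actual state.
    refine MvPolynomial.funext fun x => ?_
    have h := mem_vanishingIdeal_iff.1 hq _ ⟨fun i a p q => x (i, a, p, q), rfl⟩
    rw [aeval_rename] at h
    rw [map_zero, ← h, ← aeval_eq_eval, ← AlgHom.comp_apply, comp_aeval]
    congr 2
    funext k
    have := map_cycleState (eval x) (fun i a p q => X (i, a, p, q)) (k : Fin 4 → Fin 2)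
    simpa [aeval_eq_eval] using this

/-- The ideal generated by an irreducible polynomial is prime, so the Nullstellensatz returns it
unchanged. -/
theorem vanishingIdeal_tensorNetworkVariety_cycle :
    vanishingIdeal ℂ (tensorNetworkVariety
      (Γ := SimpleGraph.cycleGraph 4) (fun _ => 2) (fun _ => 2)) = Ideal.span {invariantSix} := by
  have := Ideal.span_singleton_prime irreducible_invariantSix.ne_zero |>.2
    irreducible_invariantSix.prime
  rw [tensorNetworkVariety, tensorNetworkStates_cycle, vanishingIdeal_range_cycleState,
    IsPrime.vanishingIdeal_zeroLocus]

/-- The parameter count is `32 - 4 + 1 - 12 = 17`, so the ambient dimension attains the minimum. -/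
theorem expectedDim_cycle :
    expectedDim (Γ := SimpleGraph.cycleGraph 4) (fun _ => 2) (fun _ => 2) = 16 := by
  have h1 : Fintype.card (SimpleGraph.cycleGraph 4).edgeSet = 4 := by
    rw [← Fintype.card_of_bijective cycleEdge_bijective, Fintype.card_fin]
  have h2 : ∀ i, Fintype.card (EdgeAt (SimpleGraph.cycleGraph 4) i) = 2 := by
    decide
  simp [expectedDim, h1, h2]

theorem affineDim_tensorNetworkVariety_cycle :
    affineDim (tensorNetworkVariety
      (Γ := SimpleGraph.cycleGraph 4) (fun _ => 2) (fun _ => 2)) = 15 := by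
  have h := ringKrullDim_quotient_span_singleton_add_one irreducible_invariantSix.ne_zero
    (x := cycleState 0) (by rw [aeval_invariantSix, det_sliceMatrix_cycleState])
  rw [affineDim, vanishingIdeal_tensorNetworkVariety_cycle]
  have h1 : (Nat.card (Fin 4 → Fin 2) : WithBot ℕ∞) = 15 + 1 := by
    rw [Nat.card_eq_fintype_card]
    simp
    norm_num
  rw [h1] at h
  generalize ringKrullDim (MvPolynomial (Fin 4 → Fin 2) ℂ ⧸ Ideal.span {invariantSix}) = d at h ⊢
  induction d with
  | bot => exact absurd h (by decide)
  | coe d =>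
    have h2 : ((d + 1 : ℕ∞) : WithBot ℕ∞) = ((15 + 1 : ℕ∞) : WithBot ℕ∞) := h
    rw [ENat.add_left_injective_of_ne_top ENat.one_ne_top (WithBot.coe_injective h2)]
    rfl

end TensorNetwork

theorem mainTheorem9 :
    -- the expected dimension is 16, the dimension is 15
    TensorNetwork.expectedDim (Γ := SimpleGraph.cycleGraph 4) (fun _ => 2) (fun _ => 2) = 16 ∧
    TensorNetwork.affineDim (TensorNetwork.tensorNetworkVariety
      (Γ := SimpleGraph.cycleGraph 4) (fun _ => 2) (fun _ => 2)) = 15 ∧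
    -- `I_6` is irreducible, homogeneous of degree 6
    Irreducible TensorNetwork.invariantSix ∧
    TensorNetwork.invariantSix.IsHomogeneous 6 ∧
    -- `I_6` is an invariant
    (∀ (g : Fin 4 → Matrix.GeneralLinearGroup (Fin 2) ℂ) (T : (Fin 4 → Fin 2) → ℂ),
      MvPolynomial.eval
          (TensorNetwork.multiApply (fun i => (g i : Matrix (Fin 2) (Fin 2) ℂ)) T)
          TensorNetwork.invariantSix =
        (∏ i, (g i : Matrix (Fin 2) (Fin 2) ℂ).det) ^ 3 *
          MvPolynomial.eval T TensorNetwork.invariantSix) ∧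
    -- the variety is the hypersurface `I_6 = 0`, and `I_6` generates its ideal
    TensorNetwork.tensorNetworkVariety
        (Γ := SimpleGraph.cycleGraph 4) (fun _ => 2) (fun _ => 2) =
      {T : (Fin 4 → Fin 2) → ℂ | MvPolynomial.eval T TensorNetwork.invariantSix = 0} ∧
    MvPolynomial.vanishingIdeal ℂ (TensorNetwork.tensorNetworkVariety
        (Γ := SimpleGraph.cycleGraph 4) (fun _ => 2) (fun _ => 2)) =
      Ideal.span {TensorNetwork.invariantSix} := by
  refine ⟨TensorNetwork.expectedDim_cycle, TensorNetwork.affineDim_tensorNetworkVariety_cycle,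
    TensorNetwork.irreducible_invariantSix, TensorNetwork.isHomogeneous_invariantSix,
    fun g T => ?_, ?_, TensorNetwork.vanishingIdeal_tensorNetworkVariety_cycle⟩
  · rw [TensorNetwork.eval_invariantSix, TensorNetwork.eval_invariantSix,
      TensorNetwork.det_sliceMatrix_multiApply]
  · rw [TensorNetwork.tensorNetworkVariety, TensorNetwork.tensorNetworkStates_cycle,
      TensorNetwork.vanishingIdeal_range_cycleState, MvPolynomial.zeroLocus_span]
    ext T
    simp [MvPolynomial.aeval_eq_eval]
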